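/- A product state in $\mathbb{C}^{d_1}\otimes\mathbb{C}^{d_2}\otimes\mathbb{C}^{d_3}$ is a vector of the form $v_1\otimes v_2\otimes v_3$ with each $v_j\in\mathbb{C}^{d_j}$ a unit vector. An unextendible product basis (UPB) of $\mathbb{C}^{d_1}\otimes\mathbb{C}^{d_2}\otimes\mathbb{C}^{d_3}$ is a set $S$ of mutually orthogonal product states such that for every product state $z\notin S$ there is $v\in S$ with $\langle v, z\rangle\neq 0$. Let $f_m(d_1,d_2,d_3)$ be the minimum number of vectors in a UPB of $\mathbb{C}^{d_1}\otimes\mathbb{C}^{d_2}\otimes\mathbb{C}^{d_3}$, and let $f_N(d_1,d_2,d_3) = \sum_{j=1}^{3}(d_j-1)+1$. **Theorem.** For every positive integer $k$, $$f_m(2,2,4k+1) = f_N(2,2,4k+1)+1 = 4k+4.$$ -/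

import Mathlib

open scoped TensorProduct

/-- The tripartite space `ℂ^{d₁} ⊗ ℂ^{d₂} ⊗ ℂ^{d₃}`, with Mathlib's inner product on the tensor
product of (Euclidean) inner product spaces. -/
abbrev TriSpace (d₁ d₂ d₃ : ℕ) : Type :=
  (EuclideanSpace ℂ (Fin d₁) ⊗[ℂ] EuclideanSpace ℂ (Fin d₂)) ⊗[ℂ] EuclideanSpace ℂ (Fin d₃)

/-- A product state: an elementary tensor of three unit vectors. -/
def IsProductState {d₁ d₂ d₃ : ℕ} (z : TriSpace d₁ d₂ d₃) : Prop :=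
  ∃ (a : EuclideanSpace ℂ (Fin d₁)) (b : EuclideanSpace ℂ (Fin d₂))
    (c : EuclideanSpace ℂ (Fin d₃)),
    ‖a‖ = 1 ∧ ‖b‖ = 1 ∧ ‖c‖ = 1 ∧ z = (a ⊗ₜ[ℂ] b) ⊗ₜ[ℂ] c

/-- An unextendible product basis of `ℂ^{d₁} ⊗ ℂ^{d₂} ⊗ ℂ^{d₃}`: a set of mutually orthogonal
product states such that no product state outside the set is orthogonal to all its elements. -/
structure IsUPB {d₁ d₂ d₃ : ℕ} (S : Set (TriSpace d₁ d₂ d₃)) : Prop where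
  isProductState : ∀ v ∈ S, IsProductState v
  orthogonal : ∀ v ∈ S, ∀ w ∈ S, v ≠ w → inner ℂ v w = 0
  unextendible : ∀ z, IsProductState z → z ∉ S → ∃ v ∈ S, inner ℂ v z ≠ 0

/-- The set of all (finite) sizes of unextendible product bases in
`ℂ^{d₁} ⊗ ℂ^{d₂} ⊗ ℂ^{d₃}`. Infinite orthogonal sets of unit vectors do not exist there. -/
def upbSizes (d₁ d₂ d₃ : ℕ) : Set ℕ :=
  {n : ℕ | ∃ S : Set (TriSpace d₁ d₂ d₃), IsUPB S ∧ S.encard = (n : ℕ∞)}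

/-- The trivial lower bound `f_N(d₁, d₂, d₃) = (d₁ - 1) + (d₂ - 1) + (d₃ - 1) + 1`, for positive
dimensions. -/
def fN (d₁ d₂ d₃ : ℕ) : ℕ := (d₁ - 1) + (d₂ - 1) + (d₃ - 1) + 1

/-- `f_m(d₁, d₂, d₃) = m`: the minimum number of vectors in an unextendible product basis of
`ℂ^{d₁} ⊗ ℂ^{d₂} ⊗ ℂ^{d₃}` exists and equals `m`. -/
def IsMinUPBSize (d₁ d₂ d₃ m : ℕ) : Prop := IsLeast (upbSizes d₁ d₂ d₃) m

/-! Lower bound: in a product basis of size `d + 2`, the trivial bound for `(2, 2, d)`, the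
orthogonality graph of each party is regular of degree one less than the dimension of its space. For
a qubit it is thus a perfect matching, so `d + 2` is even.

Construction: take the `4 m` vertices of the prism over the `2 m`-cycle. Two qubits suffice to make
adjacent vertices orthogonal: the edges split into disjoint squares for the first qubit and a
matching for the second, so a qubit vector is orthogonal to at most `2`, respectively `1`, of the
members. Non-adjacent vertices are left to the third party, whose block circulant Gram matrix has
symbol `!![w j, w 0; w 0, w (-j)]` with `w` a trigonometric polynomial of degree one. The weights
are chosen so that this matrix is positive semidefinite, and singular exactly at the frequencies
`0, 1, -1`; the third party thus spans dimension `4 m - 3`. The kernel gives three linear relations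
between the inner products of a fixed vector with the members. Their coefficients form a Vandermonde
system at distinct points, so a nonzero vector has more than `3 = 2 + 1` nonzero inner products, and
at one of these members neither qubit is orthogonal.
-/

open scoped Finset

section ProductFamilies

variable {ι A B C : Type*} [NormedAddCommGroup A] [InnerProductSpace ℂ A]
  [NormedAddCommGroup B] [InnerProductSpace ℂ B] [NormedAddCommGroup C] [InnerProductSpace ℂ C]
  {a : ι → A} {b : ι → B} {c : ι → C}

/-- The product vectors `a v ⊗ b v ⊗ c v` are nonzero, mutually orthogonal, and no product vector
is orthogonal to all of them. The conditions are spelled out on the factors, which need not be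
normalized. -/
structure IsUnextendibleFamily (a : ι → A) (b : ι → B) (c : ι → C) : Prop where
  ne_zero : ∀ v, a v ≠ 0 ∧ b v ≠ 0 ∧ c v ≠ 0
  orthogonal : ∀ v w, v ≠ w →
    inner ℂ (a v) (a w) = 0 ∨ inner ℂ (b v) (b w) = 0 ∨ inner ℂ (c v) (c w) = 0
  unextendible : ∀ x y z, x ≠ 0 → y ≠ 0 → z ≠ 0 →
    ∃ v, inner ℂ (a v) x ≠ 0 ∧ inner ℂ (b v) y ≠ 0 ∧ inner ℂ (c v) z ≠ 0

theorem exists_ne_zero_forall_inner_eq_zero {𝕜 E : Type*} [RCLike 𝕜] [NormedAddCommGroup E]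
    [InnerProductSpace 𝕜 E] (f : ι → E) (P : Finset ι) (h : #P < Module.finrank 𝕜 E) :
    ∃ x ≠ 0, ∀ v ∈ P, inner 𝕜 (f v) x = 0 := by
  have : FiniteDimensional 𝕜 E := .of_finrank_pos (by omega)
  let innerAlong : E →ₗ[𝕜] P → 𝕜 := LinearMap.pi fun v => innerₛₗ 𝕜 (f v)
  obtain ⟨x, hx, hx0⟩ := Submodule.exists_mem_ne_zero_of_ne_bot
    (innerAlong.ker_ne_bot_of_finrank_lt (by simpa using h))
  exact ⟨x, hx0, fun v hv => congrFun hx ⟨v, hv⟩⟩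

namespace IsUnextendibleFamily

theorem rotate (h : IsUnextendibleFamily a b c) : IsUnextendibleFamily b c a where
  ne_zero v := ⟨(h.ne_zero v).2.1, (h.ne_zero v).2.2, (h.ne_zero v).1⟩
  orthogonal v w hvw := by
    rcases h.orthogonal v w hvw with ha | hb | hc
    exacts [.inr (.inr ha), .inl hb, .inr (.inl hc)]
  unextendible y z x hy hz hx := by
    obtain ⟨v, ha, hb, hc⟩ := h.unextendible x y z hx hy hz
    exact ⟨v, hb, hc, ha⟩

theorem map {A' B' C' : Type*} [NormedAddCommGroup A'] [InnerProductSpace ℂ A']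
    [NormedAddCommGroup B'] [InnerProductSpace ℂ B'] [NormedAddCommGroup C']
    [InnerProductSpace ℂ C'] (h : IsUnextendibleFamily a b c) (e : A ≃ₗᵢ[ℂ] A')
    (f : B ≃ₗᵢ[ℂ] B') (g : C ≃ₗᵢ[ℂ] C') : IsUnextendibleFamily (e ∘ a) (f ∘ b) (g ∘ c) where
  ne_zero v := by simpa using h.ne_zero v
  orthogonal v w hvw := by simpa using h.orthogonal v w hvw
  unextendible x y z hx hy hz := by
    obtain ⟨v, hv⟩ := h.unextendible (e.symm x) (f.symm y) (g.symm z) (by simpa) (by simpa)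
      (by simpa)
    exact ⟨v, by simpa [LinearIsometryEquiv.inner_map_eq_flip] using hv⟩

theorem smul {r s t : ι → ℂ} (h : IsUnextendibleFamily a b c) (hr : ∀ v, r v ≠ 0)
    (hs : ∀ v, s v ≠ 0) (ht : ∀ v, t v ≠ 0) : IsUnextendibleFamily (r • a) (s • b) (t • c) where
  ne_zero v := by simpa [hr, hs, ht] using h.ne_zero v
  orthogonal v w hvw := by
    simpa [inner_smul_left, inner_smul_right, hr, hs, ht] using h.orthogonal v w hvw
  unextendible x y z hx hy hz := by
    simpa [inner_smul_left, hr, hs, ht] using h.unextendible x y z hx hy hz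

theorem card_add_finrank_le [Fintype ι] [FiniteDimensional ℂ B] [FiniteDimensional ℂ C]
    [Nontrivial B] [Nontrivial C] (h : IsUnextendibleFamily a b c) {P : Finset ι} {x : A}
    (hx : x ≠ 0) (hP : ∀ v ∈ P, inner ℂ (a v) x = 0) :
    #P + Module.finrank ℂ B + Module.finrank ℂ C ≤ Fintype.card ι + 1 := by
  classical
  by_contra! hlt
  have hB := Module.finrank_pos (R := ℂ) (M := B)
  have hC := Module.finrank_pos (R := ℂ) (M := C)
  have hcompl : #Pᶜ = Fintype.card ι - #P := Finset.card_compl P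
  obtain ⟨Q, hQ, hQcard⟩ := Finset.exists_subset_card_eq (s := Pᶜ)
    (n := min #Pᶜ (Module.finrank ℂ B - 1)) (min_le_left _ _)
  have hPQ : #(Pᶜ \ Q) = #Pᶜ - #Q := Finset.card_sdiff_of_subset hQ
  obtain ⟨y, hy, hQy⟩ := exists_ne_zero_forall_inner_eq_zero (𝕜 := ℂ) b Q (by omega)
  obtain ⟨z, hz, hPQz⟩ := exists_ne_zero_forall_inner_eq_zero (𝕜 := ℂ) c (Pᶜ \ Q) (by omega)
  obtain ⟨v, hax, hby, hcz⟩ := h.unextendible x y z hx hy hz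
  have hvP : v ∉ P := mt (hP v) hax
  have hvQ : v ∉ Q := mt (hQy v) hby
  exact hcz (hPQz v (by simp [hvP, hvQ]))

variable [Fintype ι] [FiniteDimensional ℂ A] [FiniteDimensional ℂ B] [FiniteDimensional ℂ C]
  [Nontrivial A] [Nontrivial B] [Nontrivial C]

theorem finrank_add_finrank_add_finrank_le (h : IsUnextendibleFamily a b c) :
    Module.finrank ℂ A + Module.finrank ℂ B + Module.finrank ℂ C ≤ Fintype.card ι + 2 := by
  have hA := Module.finrank_pos (R := ℂ) (M := A)
  have hB := Module.finrank_pos (R := ℂ) (M := B)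
  have hC := Module.finrank_pos (R := ℂ) (M := C)
  obtain ⟨P, -, hP⟩ := Finset.exists_subset_card_eq (s := (Finset.univ : Finset ι))
    (n := min (Fintype.card ι) (Module.finrank ℂ A - 1)) (min_le_left _ _)
  obtain ⟨x, hx, hPx⟩ := exists_ne_zero_forall_inner_eq_zero (𝕜 := ℂ) a P (by omega)
  have := h.card_add_finrank_le hx hPx
  omega

end IsUnextendibleFamily

/-- The orthogonality graph of a family of vectors. Unextendibility bounds its degrees from above,
and the three graphs of a product basis cover all pairs. -/
def orthogonalityGraph (a : ι → A) : SimpleGraph ι where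
  Adj v w := v ≠ w ∧ inner ℂ (a v) (a w) = 0
  symm := ⟨fun _ _ h => ⟨h.1.symm, inner_eq_zero_symm.1 h.2⟩⟩
  loopless := ⟨fun _ h => h.1 rfl⟩

namespace IsUnextendibleFamily

open Classical in
theorem degree_orthogonalityGraph_add_finrank_le [Fintype ι] [FiniteDimensional ℂ B]
    [FiniteDimensional ℂ C] [Nontrivial B] [Nontrivial C] (h : IsUnextendibleFamily a b c)
    (v : ι) : (orthogonalityGraph a).degree v + Module.finrank ℂ B + Module.finrank ℂ C ≤
      Fintype.card ι + 1 :=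
  h.card_add_finrank_le (h.ne_zero v).1 fun w hw =>
    inner_eq_zero_symm.1 (((orthogonalityGraph a).mem_neighborFinset v w).1 hw).2

open Classical in
theorem card_le_sum_degree_orthogonalityGraph [Fintype ι] (h : IsUnextendibleFamily a b c)
    (v : ι) : Fintype.card ι ≤ (orthogonalityGraph a).degree v + (orthogonalityGraph b).degree v +
      (orthogonalityGraph c).degree v + 1 := by
  have hcover : Finset.univ.erase v ⊆ (orthogonalityGraph a).neighborFinset v ∪
      (orthogonalityGraph b).neighborFinset v ∪ (orthogonalityGraph c).neighborFinset v := by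
    intro w hw
    have hvw : v ≠ w := (Finset.ne_of_mem_erase hw).symm
    simp only [Finset.mem_union, SimpleGraph.mem_neighborFinset]
    simpa [orthogonalityGraph, hvw, or_assoc] using h.orthogonal v w hvw
  rw [← Nat.sub_le_iff_le_add, ← Finset.card_univ, ← Finset.card_erase_of_mem (Finset.mem_univ v)]
  exact (Finset.card_le_card hcover).trans <| (Finset.card_union_le _ _).trans <|
    Nat.add_le_add_right (Finset.card_union_le _ _) _

variable [Fintype ι] [FiniteDimensional ℂ A] [FiniteDimensional ℂ B] [FiniteDimensional ℂ C]
  [Nontrivial A] [Nontrivial B] [Nontrivial C]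

open Classical in
theorem isRegularOfDegree_orthogonalityGraph (h : IsUnextendibleFamily a b c)
    (hcard : Fintype.card ι + 2 =
      Module.finrank ℂ A + Module.finrank ℂ B + Module.finrank ℂ C) :
    (orthogonalityGraph a).IsRegularOfDegree (Module.finrank ℂ A - 1) := by
  intro v
  have ha := h.degree_orthogonalityGraph_add_finrank_le v
  have hb := h.rotate.degree_orthogonalityGraph_add_finrank_le v
  have hc := h.rotate.rotate.degree_orthogonalityGraph_add_finrank_le v
  have hsum := h.card_le_sum_degree_orthogonalityGraph v
  omega

theorem even_card_mul_finrank_sub_one (h : IsUnextendibleFamily a b c)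
    (hcard : Fintype.card ι + 2 =
      Module.finrank ℂ A + Module.finrank ℂ B + Module.finrank ℂ C) :
    Even (Fintype.card ι * (Module.finrank ℂ A - 1)) := by
  classical
  have hdeg := (orthogonalityGraph a).sum_degrees_eq_twice_card_edges
  simp only [(h.isRegularOfDegree_orthogonalityGraph hcard).degree_eq, Finset.sum_const,
    Finset.card_univ, smul_eq_mul] at hdeg
  exact hdeg ▸ even_two_mul _

end IsUnextendibleFamily

end ProductFamilies

section ProductStates

variable {d₁ d₂ d₃ : ℕ}

theorem IsProductState.inner_self_ne_zero {z : TriSpace d₁ d₂ d₃} (hz : IsProductState z) :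
    inner ℂ z z ≠ 0 := by
  obtain ⟨a, b, c, ha, hb, hc, rfl⟩ := hz
  simp [inner_self_eq_norm_sq_to_K, ha, hb, hc]

theorem IsUPB.exists_inner_ne_zero {S : Set (TriSpace d₁ d₂ d₃)} (hS : IsUPB S)
    {z : TriSpace d₁ d₂ d₃} (hz : IsProductState z) : ∃ v ∈ S, inner ℂ v z ≠ 0 := by
  by_cases hzS : z ∈ S
  · exact ⟨z, hzS, hz.inner_self_ne_zero⟩
  · exact hS.unextendible z hz hzS

theorem isProductState_normalize {x : EuclideanSpace ℂ (Fin d₁)} {y : EuclideanSpace ℂ (Fin d₂)}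
    {z : EuclideanSpace ℂ (Fin d₃)} (hx : x ≠ 0) (hy : y ≠ 0) (hz : z ≠ 0) :
    IsProductState ((((‖x‖⁻¹ : ℂ) • x) ⊗ₜ[ℂ] ((‖y‖⁻¹ : ℂ) • y)) ⊗ₜ[ℂ] ((‖z‖⁻¹ : ℂ) • z)) :=
  ⟨_, _, _, norm_smul_inv_norm hx, norm_smul_inv_norm hy, norm_smul_inv_norm hz, rfl⟩

theorem IsUPB.exists_isUnextendibleFamily {S : Set (TriSpace d₁ d₂ d₃)} (hS : IsUPB S) :
    ∃ (a : S → EuclideanSpace ℂ (Fin d₁)) (b : S → EuclideanSpace ℂ (Fin d₂))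
      (c : S → EuclideanSpace ℂ (Fin d₃)), IsUnextendibleFamily a b c := by
  choose a b c ha hb hc habc using fun v : S => hS.isProductState v v.2
  refine ⟨a, b, c, fun v => ?_, fun v w hvw => ?_, fun x y z hx hy hz => ?_⟩
  · simp [← norm_ne_zero_iff, ha, hb, hc]
  · have hinner := hS.orthogonal v v.2 w w.2 (Subtype.coe_injective.ne hvw)
    simpa [habc, or_assoc] using hinner
  · obtain ⟨v, hv, hinner⟩ := hS.exists_inner_ne_zero (isProductState_normalize hx hy hz)
    rw [show v = _ from habc ⟨v, hv⟩] at hinner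
    simp only [TensorProduct.inner_tmul, inner_smul_right] at hinner
    exact ⟨⟨v, hv⟩, by simpa [hx, hy, hz, and_assoc] using hinner⟩

theorem IsUnextendibleFamily.card_mem_upbSizes_of_norm_eq_one {ι : Type*} [Fintype ι]
    {a : ι → EuclideanSpace ℂ (Fin d₁)} {b : ι → EuclideanSpace ℂ (Fin d₂)}
    {c : ι → EuclideanSpace ℂ (Fin d₃)} (h : IsUnextendibleFamily a b c) (ha : ∀ v, ‖a v‖ = 1)
    (hb : ∀ v, ‖b v‖ = 1) (hc : ∀ v, ‖c v‖ = 1) : Fintype.card ι ∈ upbSizes d₁ d₂ d₃ := by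
  let u : ι → TriSpace d₁ d₂ d₃ := fun v => (a v ⊗ₜ b v) ⊗ₜ c v
  have hu (v) : IsProductState (u v) := ⟨a v, b v, c v, ha v, hb v, hc v, rfl⟩
  have horth (v w) (hvw : v ≠ w) : inner ℂ (u v) (u w) = 0 := by
    simpa [u, or_assoc] using h.orthogonal v w hvw
  have hinj : Function.Injective u := fun v w hvw => by
    by_contra hne
    exact (hu v).inner_self_ne_zero (by simpa [hvw] using horth v w hne)
  refine ⟨Set.range u, ⟨?_, ?_, ?_⟩, ?_⟩
  · rintro _ ⟨v, rfl⟩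
    exact hu v
  · rintro _ ⟨v, rfl⟩ _ ⟨w, rfl⟩ hne
    exact horth v w (ne_of_apply_ne u hne)
  · rintro _ ⟨x, y, z, hx, hy, hz, rfl⟩ -
    obtain ⟨v, hv⟩ := h.unextendible x y z (by simp [← norm_ne_zero_iff, hx])
      (by simp [← norm_ne_zero_iff, hy]) (by simp [← norm_ne_zero_iff, hz])
    exact ⟨u v, ⟨v, rfl⟩, by simpa [u, and_assoc] using hv⟩
  · rw [← Set.image_univ, hinj.encard_image, Set.encard_univ, ENat.card_eq_coe_fintype_card]

theorem IsUnextendibleFamily.card_mem_upbSizes {ι A B C : Type*} [Fintype ι]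
    [NormedAddCommGroup A] [InnerProductSpace ℂ A] [FiniteDimensional ℂ A]
    [NormedAddCommGroup B] [InnerProductSpace ℂ B] [FiniteDimensional ℂ B]
    [NormedAddCommGroup C] [InnerProductSpace ℂ C] [FiniteDimensional ℂ C]
    {a : ι → A} {b : ι → B} {c : ι → C} (h : IsUnextendibleFamily a b c) :
    Fintype.card ι ∈
      upbSizes (Module.finrank ℂ A) (Module.finrank ℂ B) (Module.finrank ℂ C) := by
  have h' := h.map (stdOrthonormalBasis ℂ A).repr (stdOrthonormalBasis ℂ B).repr
    (stdOrthonormalBasis ℂ C).repr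
  refine (h'.smul (r := fun v => (‖a v‖⁻¹ : ℂ)) (s := fun v => (‖b v‖⁻¹ : ℂ))
    (t := fun v => (‖c v‖⁻¹ : ℂ)) ?_ ?_ ?_).card_mem_upbSizes_of_norm_eq_one ?_ ?_ ?_ <;>
    intro v <;> simp [norm_smul, h.ne_zero v]

theorem le_of_mem_upbSizes_two_two {d n : ℕ} (hd : Odd d) (hn : n ∈ upbSizes 2 2 d) :
    d + 3 ≤ n := by
  obtain ⟨S, hS, hcard⟩ := hn
  have : Fintype S := (Set.finite_of_encard_eq_coe hcard).fintype
  have hSn : Fintype.card S = n := by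
    rwa [Set.encard, ENat.card_eq_coe_fintype_card, Nat.cast_inj] at hcard
  have : NeZero d := ⟨hd.pos.ne'⟩
  obtain ⟨a, b, c, h⟩ := hS.exists_isUnextendibleFamily
  have hle := h.finrank_add_finrank_add_finrank_le
  have hparity := h.even_card_mul_finrank_sub_one
  simp only [finrank_euclideanSpace_fin, hSn] at hle hparity
  grind

end ProductStates

section PrismGraph

/-- The prism over the cycle on `ZMod N`: two copies of the cycle, called layers and indexed by
`Fin 2`, joined by the perfect matching of rungs `(t, 0) — (t, 1)`. -/
def prismGraph (N : ℕ) : SimpleGraph (ZMod N × Fin 2) :=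
  SimpleGraph.circulantGraph {1} □ ⊤

theorem prismGraph_adj {N : ℕ} (hN : N ≠ 1) {v w : ZMod N × Fin 2} :
    (prismGraph N).Adj v w ↔
      (v.1 = w.1 + 1 ∨ w.1 = v.1 + 1) ∧ v.2 = w.2 ∨ v.1 = w.1 ∧ v.2 ≠ w.2 := by
  have hloop (t t' : ZMod N) (h : t = t' + 1 ∨ t' = t + 1) : t ≠ t' := by
    rintro rfl
    have := ZMod.nontrivial_iff.2 hN
    simp at h
  simp only [prismGraph, SimpleGraph.boxProd_adj, SimpleGraph.circulantGraph_adj,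
    Set.mem_singleton_iff, SimpleGraph.top_adj, sub_eq_iff_eq_add, add_comm (1 : ZMod N)]
  grind

end PrismGraph

section PlanarVectors

theorem eq_of_inner_eq_zero_of_ne_zero {r r' : ℝ} {x : EuclideanSpace ℂ (Fin 2)} (hx : x ≠ 0)
    (h : inner ℂ !₂[1, (r : ℂ)] x = 0) (h' : inner ℂ !₂[1, (r' : ℂ)] x = 0) : r = r' := by
  simp only [PiLp.inner_apply, Fin.sum_univ_two, RCLike.inner_apply,
    Matrix.cons_val_zero, Matrix.cons_val_one, map_one, mul_one, Complex.conj_ofReal] at h h'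
  by_contra hne
  have hx1 : x 1 = 0 := by
    have : x 1 * ((r : ℂ) - r') = 0 := by linear_combination h - h'
    simpa [sub_eq_zero, hne] using this
  have hx0 : x 0 = 0 := by simpa [hx1] using h
  exact hx (by ext i; fin_cases i <;> simpa)

theorem exists_planar_orthogonal_pairs (Λ : Type*) [Countable Λ] :
    ∃ u : Λ → Fin 2 → EuclideanSpace ℂ (Fin 2), (∀ l e, u l e ≠ 0) ∧
      (∀ l e e', e ≠ e' → inner ℂ (u l e) (u l e') = 0) ∧
      ∀ x ≠ 0, ∀ l e l' e', inner ℂ (u l e) x = 0 → inner ℂ (u l' e') x = 0 →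
        l = l' ∧ e = e' := by
  obtain ⟨f, hf⟩ := Countable.exists_injective_nat Λ
  let slope (l : Λ) (e : Fin 2) : ℝ := if e = 0 then f l + 1 else -(f l + 1 : ℝ)⁻¹
  have hpos (l) : (0 : ℝ) < f l + 1 := by positivity
  refine ⟨fun l e => !₂[1, (slope l e : ℂ)], fun l e h => ?_, fun l e e' he => ?_,
    fun x hx l e l' e' h h' => ?_⟩
  · simpa using congrArg (· 0) h
  · have : 1 + (slope l e : ℂ) * slope l e' = 0 := by
      have := hpos l
      norm_cast
      fin_cases e <;> fin_cases e' <;> simp_all [slope] <;> field_simp <;> norm_num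
    simpa [PiLp.inner_apply, mul_comm] using this
  · have hslope := eq_of_inner_eq_zero_of_ne_zero hx h h'
    have hl := hpos l
    have hl' := hpos l'
    have := inv_pos.2 hl
    have := inv_pos.2 hl'
    fin_cases e <;> fin_cases e'
    · exact ⟨hf (by simpa [slope] using hslope), rfl⟩
    · simp [slope] at hslope
      linarith
    · simp [slope] at hslope
      linarith
    · exact ⟨hf (by simpa [slope] using hslope), rfl⟩

end PlanarVectors

section PlanarParties

variable {m : ℕ}

/-- The proper `2`-colouring of the even cycle `ZMod (2 * m)`. -/
def cycleParity (t : ZMod (2 * m)) : Fin 2 :=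
  (ZMod.castHom (dvd_mul_right 2 m) (ZMod 2) t : ZMod 2)

theorem cycleParity_add_one (t : ZMod (2 * m)) : cycleParity (t + 1) = cycleParity t + 1 :=
  (map_add _ t 1).trans (congrArg _ (map_one _))

/-- The edges `{t, t + 1}` of the even cycle form two perfect matchings, according to the colour
of `t`. This is the starting point of the edge of class `p` through `t`. -/
def edgeStart (p : Fin 2) (t : ZMod (2 * m)) : ZMod (2 * m) :=
  if cycleParity t = p then t else t - 1

theorem edgeStart_add_one (t : ZMod (2 * m)) :
    edgeStart (cycleParity t) (t + 1) = edgeStart (cycleParity t) t := by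
  simp [edgeStart, cycleParity_add_one]

theorem eq_of_edgeStart_eq {p : Fin 2} {t t' : ZMod (2 * m)} (h : edgeStart p t = edgeStart p t')
    (hparity : cycleParity t = cycleParity t') : t = t' := by
  simp only [edgeStart, hparity] at h
  split_ifs at h
  · exact h
  · exact sub_left_injective h

theorem exists_family_orthogonal_on_squares :
    ∃ a : ZMod (2 * m) × Fin 2 → EuclideanSpace ℂ (Fin 2), (∀ v, a v ≠ 0) ∧
      (∀ t s s', s ≠ s' → inner ℂ (a (t, s)) (a (t, s')) = 0) ∧
      (∀ t s, cycleParity t = 0 → inner ℂ (a (t, s)) (a (t + 1, s)) = 0) ∧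
      ∀ x ≠ 0, ∀ P : Finset (ZMod (2 * m) × Fin 2), (∀ v ∈ P, inner ℂ (a v) x = 0) → #P ≤ 2 := by
  have : Countable (ZMod (2 * m)) := ZMod.intCast_surjective.countable
  obtain ⟨u, hu, horth, hsep⟩ := exists_planar_orthogonal_pairs (ZMod (2 * m))
  refine ⟨fun v => u (edgeStart 0 v.1) (cycleParity v.1 + v.2), fun v => hu _ _,
    fun t s s' hs => horth _ _ _ (by simpa using hs), fun t s ht => ?_, fun x hx P hP => ?_⟩
  · have hedge : edgeStart 0 (t + 1) = edgeStart 0 t := ht ▸ edgeStart_add_one t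
    dsimp only
    rw [hedge]
    exact horth _ _ _ (by simp [cycleParity_add_one])
  · have hinj : Set.InjOn Prod.snd (P : Set (ZMod (2 * m) × Fin 2)) := fun v hv w hw hlayer => by
      obtain ⟨hstart, hside⟩ := hsep x hx _ _ _ _ (hP v hv) (hP w hw)
      rw [hlayer] at hside
      exact Prod.ext (eq_of_edgeStart_eq hstart (add_right_cancel hside)) hlayer
    simpa using Finset.card_le_card_of_injOn Prod.snd (fun v _ => Finset.mem_univ v.2) hinj

theorem exists_family_orthogonal_on_matching :
    ∃ b : ZMod (2 * m) × Fin 2 → EuclideanSpace ℂ (Fin 2), (∀ v, b v ≠ 0) ∧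
      (∀ t s, cycleParity t = 1 → inner ℂ (b (t, s)) (b (t + 1, s)) = 0) ∧
      ∀ y ≠ 0, ∀ P : Finset (ZMod (2 * m) × Fin 2), (∀ v ∈ P, inner ℂ (b v) y = 0) → #P ≤ 1 := by
  have : Countable (ZMod (2 * m)) := ZMod.intCast_surjective.countable
  obtain ⟨u, hu, horth, hsep⟩ := exists_planar_orthogonal_pairs (ZMod (2 * m) × Fin 2)
  refine ⟨fun v => u (edgeStart 1 v.1, v.2) (cycleParity v.1), fun v => hu _ _, fun t s ht => ?_,
    fun y hy P hP => Finset.card_le_one.2 fun v hv w hw => ?_⟩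
  · have hedge : edgeStart 1 (t + 1) = edgeStart 1 t := ht ▸ edgeStart_add_one t
    dsimp only
    rw [hedge]
    exact horth _ _ _ (by simp [cycleParity_add_one])
  · obtain ⟨hlabel, hside⟩ := hsep y hy _ _ _ _ (hP v hv) (hP w hw)
    obtain ⟨hstart, hlayer⟩ := Prod.ext_iff.1 hlabel
    exact Prod.ext (eq_of_edgeStart_eq hstart hside) hlayer

theorem exists_planar_families (m : ℕ) :
    ∃ a b : ZMod (2 * m) × Fin 2 → EuclideanSpace ℂ (Fin 2), (∀ v, a v ≠ 0 ∧ b v ≠ 0) ∧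
      (∀ v w, (prismGraph (2 * m)).Adj v w →
        inner ℂ (a v) (a w) = 0 ∨ inner ℂ (b v) (b w) = 0) ∧
      (∀ x ≠ 0, ∀ P : Finset (ZMod (2 * m) × Fin 2), (∀ v ∈ P, inner ℂ (a v) x = 0) → #P ≤ 2) ∧
      ∀ y ≠ 0, ∀ P : Finset (ZMod (2 * m) × Fin 2), (∀ v ∈ P, inner ℂ (b v) y = 0) → #P ≤ 1 := by
  obtain ⟨a, ha, hrung, hsquare, hacard⟩ := exists_family_orthogonal_on_squares (m := m)
  obtain ⟨b, hb, hmatching, hbcard⟩ := exists_family_orthogonal_on_matching (m := m)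
  have hstep (t s) : inner ℂ (a (t, s)) (a (t + 1, s)) = 0 ∨
      inner ℂ (b (t, s)) (b (t + 1, s)) = 0 := by
    obtain ht | ht : cycleParity t = 0 ∨ cycleParity t = 1 := by omega
    exacts [.inl (hsquare t s ht), .inr (hmatching t s ht)]
  refine ⟨a, b, fun v => ⟨ha v, hb v⟩, ?_, hacard, hbcard⟩
  rintro ⟨t, s⟩ ⟨t', s'⟩ hadj
  have hadj' := (prismGraph_adj (by omega)).1 hadj
  dsimp only at hadj'
  obtain ⟨rfl | rfl, rfl⟩ | ⟨rfl, hs⟩ := hadj'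
  · exact (hstep t' s).imp inner_eq_zero_symm.1 inner_eq_zero_symm.1
  · exact hstep t s
  · exact .inl (hrung t s s' hs)

end PlanarParties

section SparseSolutions

open Polynomial in
theorem lt_card_filter_ne_zero_of_sum_pow_mul_eq_zero {K ι : Type*} [Field K] [DecidableEq K]
    [Fintype ι] {ζ y : ι → K} (hζ : Function.Injective ζ) (hy : y ≠ 0) {n : ℕ}
    (hsum : ∀ k < n, ∑ v, ζ v ^ k * y v = 0) : n < #{v | y v ≠ 0} := by
  classical
  by_contra! hcard
  obtain ⟨v, hv⟩ := Function.ne_iff.1 hy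
  set s : Finset ι := {v | y v ≠ 0}
  have hvs : v ∈ s := by simpa [s] using hv
  have hdegree : (Lagrange.basis s ζ v).natDegree < n := by
    have hpos := Finset.card_pos.2 ⟨v, hvs⟩
    rw [Lagrange.natDegree_basis hζ.injOn hvs]
    omega
  have hannihilates : ∑ w, (Lagrange.basis s ζ v).eval (ζ w) * y w = 0 := by
    simp_rw [eval_eq_sum_range' hdegree, Finset.sum_mul, mul_assoc]
    rw [Finset.sum_comm]
    refine Finset.sum_eq_zero fun k hk => ?_
    rw [← Finset.mul_sum, hsum k (Finset.mem_range.1 hk), mul_zero]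
  rw [Finset.sum_eq_single v, Lagrange.eval_basis_self hζ.injOn hvs, one_mul] at hannihilates
  · exact hv hannihilates
  · intro w _ hwv
    by_cases hws : w ∈ s
    · rw [Lagrange.eval_basis_of_ne hwv.symm hws, zero_mul]
    · rw [show y w = 0 by simpa [s] using hws, mul_zero]
  · simp

end SparseSolutions

section CoordinateSubspace

variable {𝕜 ι : Type*} [RCLike 𝕜] [Fintype ι] [DecidableEq ι]

/-- The coordinate subspace of vectors whose entries vanish on `s`. The space of the third party is
of this form. -/
noncomputable def vanishingSubspace (𝕜 : Type*) [RCLike 𝕜] (s : Finset ι) :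
    Submodule 𝕜 (EuclideanSpace 𝕜 ι) :=
  (Submodule.span 𝕜 (Set.range fun i : s => EuclideanSpace.single (i : ι) (1 : 𝕜)))ᗮ

theorem mem_vanishingSubspace {s : Finset ι} {y : EuclideanSpace 𝕜 ι} :
    y ∈ vanishingSubspace 𝕜 s ↔ ∀ i ∈ s, y i = 0 := by
  rw [vanishingSubspace, ← Submodule.span_singleton_le_iff_mem, ← Submodule.isOrtho_iff_le,
    Submodule.isOrtho_comm, Submodule.isOrtho_span]
  simp [EuclideanSpace.inner_single_left]

theorem finrank_vanishingSubspace (s : Finset ι) :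
    Module.finrank 𝕜 (vanishingSubspace 𝕜 s) = Fintype.card ι - #s := by
  have hindep : LinearIndependent 𝕜 fun i : s => EuclideanSpace.single (i : ι) (1 : 𝕜) :=
    ((EuclideanSpace.orthonormal_single (𝕜 := 𝕜)).comp _ Subtype.val_injective).linearIndependent
  have hspan := finrank_span_eq_card hindep
  have hsum := Submodule.finrank_add_finrank_orthogonal
    (Submodule.span 𝕜 (Set.range fun i : s => EuclideanSpace.single (i : ι) (1 : 𝕜)))
  rw [hspan, Fintype.card_coe, finrank_euclideanSpace] at hsum
  rw [vanishingSubspace]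
  omega

end CoordinateSubspace

section CirculantParty

variable {N : ℕ} [NeZero N]

local notation "χ" => (ZMod.stdAddChar : AddChar (ZMod N) ℂ)

theorem conj_stdAddChar (j : ZMod N) : (starRingEnd ℂ) (χ j) = χ (-j) :=
  (AddChar.map_neg_eq_conj _ _).symm

theorem re_sq_add_im_sq_stdAddChar (j : ZMod N) : (χ j).re ^ 2 + (χ j).im ^ 2 = 1 := by
  have := Complex.sq_norm (χ j)
  rw [AddChar.norm_apply, Complex.normSq_apply] at this
  linarith

theorem re_stdAddChar_intCast (k : ℤ) : (χ k).re = Real.cos (2 * Real.pi * k / N) := by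
  rw [ZMod.stdAddChar_coe, show (2 * Real.pi * Complex.I * k / N : ℂ) =
    ((2 * Real.pi * k / N : ℝ) : ℂ) * Complex.I by push_cast; ring, Complex.exp_ofReal_mul_I_re]

theorem re_stdAddChar_lt {j : ZMod N} (h0 : j ≠ 0) (h1 : j ≠ 1) (h2 : j ≠ -1) :
    (χ j).re < (χ 1).re := by
  obtain ⟨k, rfl, hk⟩ : ∃ k : ℤ, (k : ZMod N) = j ∧ k * 2 ∈ Set.Ioc (-N : ℤ) N :=
    ⟨_, j.coe_valMinAbs, j.valMinAbs_mem_Ioc⟩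
  have hN : (0 : ℝ) < N := by exact_mod_cast NeZero.pos N
  have habs_ge : 2 ≤ |k| := by
    have hk0 : k ≠ 0 := by rintro rfl; simp at h0
    have hk1 : k ≠ 1 := by rintro rfl; simp at h1
    have hk2 : k ≠ -1 := by rintro rfl; simp at h2
    grind
  have habs_le : |k| * 2 ≤ N := by grind
  have hone : (χ 1).re = Real.cos (2 * Real.pi * 1 / N) := by
    simpa using re_stdAddChar_intCast (N := N) 1
  rw [hone, re_stdAddChar_intCast, ← Real.cos_abs, abs_div, abs_mul, abs_of_pos hN,
    abs_of_pos Real.two_pi_pos]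
  have hge : (2 : ℝ) ≤ |(k : ℝ)| := by exact_mod_cast habs_ge
  have hle : |(k : ℝ)| * 2 ≤ N := by exact_mod_cast habs_le
  refine Real.cos_lt_cos_of_nonneg_of_le_pi (by positivity) ?_ (by gcongr; linarith)
  rw [div_le_iff₀ hN]
  nlinarith [Real.pi_pos]

theorem im_stdAddChar_one_ne_zero (hN : 3 ≤ N) : (χ 1).im ≠ 0 := by
  intro him
  have hneg : (1 : ZMod N) = -1 := ZMod.injective_stdAddChar <| by
    rw [← conj_stdAddChar, Complex.conj_eq_iff_im.2 him]
  have : Fact (2 < N) := ⟨hN⟩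
  exact ZMod.neg_one_ne_one hneg.symm

theorem sum_stdAddChar_mul {d : ZMod N} (hd : d ≠ 0) : ∑ j, χ (j * d) = 0 := by
  rw [AddChar.sum_mulShift d (ZMod.isPrimitive_stdAddChar N), if_neg hd, Nat.cast_zero]

/-- The constant `b` in the weights `w j = b² + 4 - 2 b Re χ(j) - 4 Im χ(j)`. It is chosen so that
`w j * w (-j) - w 0 ^ 2` is a quadratic polynomial in `Re χ(j)` with roots `1` and `Re χ(1)`. -/
noncomputable def weightParameter (N : ℕ) [NeZero N] : ℝ :=
  1 + (ZMod.stdAddChar (1 : ZMod N)).re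

/-- The weight of the frequency `j`, a trigonometric polynomial of degree one in `j`. -/
noncomputable def weight (j : ZMod N) : ℝ :=
  weightParameter N ^ 2 + 4 - 2 * weightParameter N * (χ j).re - 4 * (χ j).im

theorem ofReal_weight (j : ZMod N) :
    (weight j : ℂ) = (weightParameter N ^ 2 + 4 : ℝ) -
      (weightParameter N - 2 * Complex.I) * χ j - (weightParameter N + 2 * Complex.I) * χ (-j) := by
  rw [← conj_stdAddChar]
  apply Complex.ext <;> simp [weight] <;> ring

theorem weight_mul_weight_neg (j : ZMod N) :
    weight j * weight (-j) = weight (0 : ZMod N) ^ 2 +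
      4 * (weightParameter N ^ 2 + 4) * (1 - (χ j).re) * ((χ 1).re - (χ j).re) := by
  have hcircle := re_sq_add_im_sq_stdAddChar j
  simp only [weight, weightParameter, ← conj_stdAddChar, Complex.conj_re, Complex.conj_im,
    AddChar.map_zero_eq_one, Complex.one_re, Complex.one_im]
  linear_combination (-16) * hcircle

theorem weight_pos (hN : 3 ≤ N) (j : ZMod N) : 0 < weight j := by
  have hparam : 0 < weightParameter N := by
    have := im_stdAddChar_one_ne_zero hN
    have := re_sq_add_im_sq_stdAddChar (1 : ZMod N)
    have : 0 < (χ 1).im ^ 2 := by positivity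
    rw [weightParameter]
    nlinarith
  have hcircle := re_sq_add_im_sq_stdAddChar j
  have hsquares : weight j = (weightParameter N - (χ j).re) ^ 2 + (2 - (χ j).im) ^ 2 - 1 := by
    rw [weight]
    linear_combination -hcircle
  rcases (show (χ j).im ≤ 1 by nlinarith).lt_or_eq with him | him
  · nlinarith [sq_nonneg (weightParameter N - (χ j).re)]
  · have hre : (χ j).re = 0 := by simpa [him] using hcircle
    rw [hsquares, him, hre]
    nlinarith

theorem weight_one_ne_weight_zero (hN : 3 ≤ N) : weight (1 : ZMod N) ≠ weight (0 : ZMod N) := by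
  have him := im_stdAddChar_one_ne_zero hN
  have hcircle := re_sq_add_im_sq_stdAddChar (1 : ZMod N)
  have hdiff : weight (1 : ZMod N) - weight (0 : ZMod N) = 2 * (χ 1).im * ((χ 1).im - 2) := by
    simp only [weight, weightParameter, AddChar.map_zero_eq_one, Complex.one_re, Complex.one_im]
    linear_combination -2 * hcircle
  have him_lt : (χ 1).im - 2 ≠ 0 := by nlinarith
  rw [← sub_ne_zero, hdiff]
  positivity

/-- The frequencies `0, 1, -1`, at which the weighted Gram matrix is singular. -/
def singularFrequencies (N : ℕ) : Finset (ZMod N) := {0, 1, -1}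

theorem weight_mul_weight_neg_of_mem {j : ZMod N} (hj : j ∈ singularFrequencies N) :
    weight j * weight (-j) = weight (0 : ZMod N) ^ 2 := by
  simp only [singularFrequencies, Finset.mem_insert, Finset.mem_singleton] at hj
  rw [weight_mul_weight_neg]
  rcases hj with rfl | rfl | rfl <;> simp [← conj_stdAddChar]

theorem weight_zero_sq_lt {j : ZMod N} (hj : j ∉ singularFrequencies N) :
    weight (0 : ZMod N) ^ 2 < weight j * weight (-j) := by
  simp only [singularFrequencies, Finset.mem_insert, Finset.mem_singleton, not_or] at hj
  have hlt := re_stdAddChar_lt hj.1 hj.2.1 hj.2.2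
  have hle : (χ 1).re ≤ 1 := (Complex.re_le_norm _).trans (AddChar.norm_apply _ _).le
  have : 0 < 1 - (χ j).re := by linarith
  have : 0 < (χ 1).re - (χ j).re := by linarith
  rw [weight_mul_weight_neg]
  have : 0 < 4 * (weightParameter N ^ 2 + 4) * (1 - (χ j).re) * ((χ 1).re - (χ j).re) := by
    positivity
  linarith

/-- The upper triangular Cholesky factor of the Gram matrix `!![w j, w 0; w 0, w (-j)]`. -/
noncomputable def weightFactor (j : ZMod N) : Matrix (Fin 2) (Fin 2) ℝ :=
  !![√(weight j), weight (0 : ZMod N) / √(weight j);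
    0, √(weight (-j) - weight (0 : ZMod N) ^ 2 / weight j)]

open Matrix in
theorem transpose_weightFactor_mul_self (hN : 3 ≤ N) (j : ZMod N) :
    (weightFactor j)ᵀ * weightFactor j =
      !![weight j, weight (0 : ZMod N); weight (0 : ZMod N), weight (-j)] := by
  have hpos := weight_pos hN j
  have hschur : 0 ≤ weight (-j) - weight (0 : ZMod N) ^ 2 / weight j := by
    rw [sub_nonneg, div_le_iff₀ hpos, mul_comm]
    by_cases hj : j ∈ singularFrequencies N
    · exact (weight_mul_weight_neg_of_mem hj).ge
    · exact (weight_zero_sq_lt hj).le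
  have hne := (Real.sqrt_pos.2 hpos).ne'
  ext r s
  fin_cases r <;> fin_cases s <;>
    simp [weightFactor, Matrix.mul_apply, Fin.sum_univ_two, ← sq, hschur, hpos.le, div_pow] <;>
    field_simp

theorem weightFactor_one_one_eq_zero (hN : 3 ≤ N) {j : ZMod N} (hj : j ∈ singularFrequencies N) :
    weightFactor j 1 1 = 0 := by
  have hpos := weight_pos hN j
  simp [weightFactor, ← weight_mul_weight_neg_of_mem hj, hpos.ne']

theorem weightFactor_one_one_ne_zero (hN : 3 ≤ N) {j : ZMod N}
    (hj : j ∉ singularFrequencies N) : weightFactor j 1 1 ≠ 0 := by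
  refine (Real.sqrt_pos.2 ?_).ne'
  rw [sub_pos, div_lt_iff₀ (weight_pos hN j), mul_comm]
  exact weight_zero_sq_lt hj

/-- The ambient family of the third party. Its Gram matrix is block circulant with symbol
`!![w j, w 0; w 0, w (-j)]`. -/
noncomputable def circulantVector (v : ZMod N × Fin 2) : EuclideanSpace ℂ (ZMod N × Fin 2) :=
  WithLp.toLp 2 fun i => χ (i.1 * v.1) * weightFactor i.1 i.2 v.2

/-- The coordinates `(j, 1)` with `j` a singular frequency, which vanish on all circulant
vectors. -/
def singularCoordinates (N : ℕ) : Finset (ZMod N × Fin 2) := singularFrequencies N ×ˢ {1}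

theorem circulantVector_ne_zero (hN : 3 ≤ N) (v : ZMod N × Fin 2) : circulantVector v ≠ 0 := by
  have hpos := weight_pos hN (0 : ZMod N)
  intro h
  have hentry : (weightFactor (0 : ZMod N) 0 v.2 : ℂ) = 0 := by
    simpa [circulantVector] using congrArg (· ((0 : ZMod N), (0 : Fin 2))) h
  obtain ⟨t, s⟩ := v
  fin_cases s <;> simp [weightFactor, Real.sqrt_eq_zero', hpos.not_ge] at hentry

theorem circulantVector_mem (hN : 3 ≤ N) (v : ZMod N × Fin 2) :
    circulantVector v ∈ vanishingSubspace ℂ (singularCoordinates N) := by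
  rw [mem_vanishingSubspace]
  rintro ⟨j, r⟩ hi
  obtain ⟨hj, rfl⟩ : j ∈ singularFrequencies N ∧ r = 1 := by
    simpa [singularCoordinates, eq_comm] using hi
  have hrow : weightFactor j 1 v.2 = 0 := by
    obtain ⟨t, s⟩ := v
    fin_cases s
    exacts [rfl, weightFactor_one_one_eq_zero hN hj]
  simp [circulantVector, hrow]

theorem inner_circulantVector (hN : 3 ≤ N) (v w : ZMod N × Fin 2) :
    inner ℂ (circulantVector v) (circulantVector w) = ∑ j, χ (j * (w.1 - v.1)) *
      (!![weight j, weight (0 : ZMod N); weight (0 : ZMod N), weight (-j)] v.2 w.2 : ℝ) := by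
  simp only [PiLp.inner_apply, circulantVector, RCLike.inner_apply, Fintype.sum_prod_type,
    ← transpose_weightFactor_mul_self hN, Matrix.mul_apply, Matrix.transpose_apply,
    Complex.ofReal_sum, Complex.ofReal_mul, Finset.mul_sum, map_mul, conj_stdAddChar,
    Complex.conj_ofReal, sub_eq_add_neg, mul_add, mul_neg, AddChar.map_add_eq_mul]
  refine Finset.sum_congr rfl fun j _ => Finset.sum_congr rfl fun r _ => ?_
  ring

theorem sum_stdAddChar_mul_weight {d : ZMod N} (h0 : d ≠ 0) (h1 : d ≠ 1) (h2 : d ≠ -1) :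
    ∑ j, χ (j * d) * weight j = 0 := by
  have hsub : d - 1 ≠ 0 := sub_ne_zero.2 h1
  have hadd : d + 1 ≠ 0 := by rwa [← sub_neg_eq_add, sub_ne_zero]
  have hterm (j : ZMod N) : χ (j * d) * weight j =
      (weightParameter N ^ 2 + 4 : ℝ) * χ (j * d) -
        (weightParameter N - 2 * Complex.I) * χ (j * (d + 1)) -
        (weightParameter N + 2 * Complex.I) * χ (j * (d - 1)) := by
    simp only [ofReal_weight, sub_eq_add_neg, mul_add, mul_neg, mul_one, AddChar.map_add_eq_mul]
    ring
  simp_rw [hterm, Finset.sum_sub_distrib, ← Finset.mul_sum]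
  simp [sum_stdAddChar_mul h0, sum_stdAddChar_mul hsub, sum_stdAddChar_mul hadd]

theorem inner_circulantVector_eq_zero (hN : 3 ≤ N) {v w : ZMod N × Fin 2} (hvw : v ≠ w)
    (hadj : ¬ (prismGraph N).Adj v w) : inner ℂ (circulantVector v) (circulantVector w) = 0 := by
  obtain ⟨t, s⟩ := v
  obtain ⟨t', s'⟩ := w
  rw [prismGraph_adj (by omega)] at hadj
  rw [inner_circulantVector hN]
  by_cases hs : s = s'
  · subst hs
    have h0 : t' - t ≠ 0 := by grind
    have h1 : t' - t ≠ 1 := by grind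
    have h2 : t' - t ≠ -1 := by grind
    fin_cases s
    · exact sum_stdAddChar_mul_weight h0 h1 h2
    · rw [← sum_stdAddChar_mul_weight (neg_ne_zero.2 h0) (by rwa [Ne, neg_eq_iff_eq_neg])
        (neg_injective.ne h1)]
      exact Fintype.sum_equiv (Equiv.neg _) _ _ fun j => by
        simp only [Equiv.neg_apply, neg_mul_neg]
        rfl
  · have hd : t' - t ≠ 0 := by grind
    fin_cases s <;> fin_cases s' <;>
      simp [← Finset.sum_mul, sum_stdAddChar_mul hd] at hs ⊢

/-- The coefficient of the frequency `j` in the inner products of `z` with the circulant vectors of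
layer `s`. -/
noncomputable def layerSpectrum (z : EuclideanSpace ℂ (ZMod N × Fin 2)) (s : Fin 2) (j : ZMod N) :
    ℂ :=
  ∑ r, weightFactor j r s * z (j, r)

theorem inner_circulantVector_eq_dft (v : ZMod N × Fin 2)
    (z : EuclideanSpace ℂ (ZMod N × Fin 2)) :
    inner ℂ (circulantVector v) z = ZMod.dft (layerSpectrum z v.2) v.1 := by
  simp only [PiLp.inner_apply, circulantVector, RCLike.inner_apply, Fintype.sum_prod_type,
    map_mul, conj_stdAddChar, Complex.conj_ofReal, ZMod.dft_apply, layerSpectrum, smul_eq_mul,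
    Finset.mul_sum]
  refine Finset.sum_congr rfl fun j _ => Finset.sum_congr rfl fun r _ => ?_
  ring

theorem sum_stdAddChar_mul_inner_circulantVector (z : EuclideanSpace ℂ (ZMod N × Fin 2))
    (s : Fin 2) (j : ZMod N) :
    ∑ t, χ (t * j) * inner ℂ (circulantVector (t, s)) z = N * layerSpectrum z s j := by
  have h := congrFun (ZMod.dft.symm_apply_apply (layerSpectrum z s)) j
  simp only [ZMod.invDFT_apply, smul_eq_mul] at h
  simp_rw [inner_circulantVector_eq_dft, ← h]
  rw [mul_inv_cancel_left₀ (NeZero.ne _)]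

theorem eq_zero_of_inner_circulantVector_eq_zero (hN : 3 ≤ N)
    {z : EuclideanSpace ℂ (ZMod N × Fin 2)}
    (hz : z ∈ vanishingSubspace ℂ (singularCoordinates N))
    (h : ∀ v, inner ℂ (circulantVector v) z = 0) : z = 0 := by
  have hspectrum (s j) : layerSpectrum z s j = 0 := by
    simpa [h, eq_comm, NeZero.ne] using sum_stdAddChar_mul_inner_circulantVector z s j
  have hzero (j : ZMod N) : z (j, 0) = 0 := by
    have hpos := Real.sqrt_pos.2 (weight_pos hN j)
    simpa [layerSpectrum, weightFactor, hpos.ne'] using hspectrum 0 j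
  ext ⟨j, r⟩
  fin_cases r
  · exact hzero j
  · by_cases hj : j ∈ singularFrequencies N
    · exact mem_vanishingSubspace.1 hz (j, 1) (by simpa [singularCoordinates] using hj)
    · simpa [layerSpectrum, hzero, weightFactor_one_one_ne_zero hN hj] using hspectrum 1 j

theorem weight_zero_mul_layerSpectrum (hN : 3 ≤ N) {z : EuclideanSpace ℂ (ZMod N × Fin 2)}
    (hz : z ∈ vanishingSubspace ℂ (singularCoordinates N)) {j : ZMod N}
    (hj : j ∈ singularFrequencies N) :
    weight (0 : ZMod N) * layerSpectrum z 0 j = weight j * layerSpectrum z 1 j := by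
  have hvanish : z (j, 1) = 0 :=
    mem_vanishingSubspace.1 hz (j, 1) (by simpa [singularCoordinates] using hj)
  have hpos := Real.sqrt_pos.2 (weight_pos hN j)
  have hfactor : weight (0 : ZMod N) * √(weight j) =
      weight j * (weight (0 : ZMod N) / √(weight j)) := by
    rw [← mul_div_assoc, eq_div_iff hpos.ne', mul_assoc,
      Real.mul_self_sqrt (weight_pos hN j).le, mul_comm]
  simp only [layerSpectrum, weightFactor, Fin.sum_univ_two, hvanish, mul_zero, add_zero,
    ← mul_assoc, ← Complex.ofReal_mul]
  simp [← hfactor]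

/-- The points `(w 1 / w 0) ^ s * χ(t)` of two concentric circles. Every vector of the third party
has inner products with the circulant vectors that satisfy three linear relations, whose
coefficients at the vertex `(t, s)` are, up to sign, the powers `-1`, `0` and `1` of this point. -/
noncomputable def circlePoint (v : ZMod N × Fin 2) : ℂ :=
  (weight (1 : ZMod N) / weight (0 : ZMod N) : ℂ) ^ (v.2 : ℕ) * χ v.1

theorem circlePoint_ne_zero (hN : 3 ≤ N) (v : ZMod N × Fin 2) : circlePoint v ≠ 0 := by
  have h0 := (weight_pos hN (0 : ZMod N)).ne'
  have h1 := (weight_pos hN (1 : ZMod N)).ne'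
  simp [circlePoint, h0, h1, (AddChar.val_isUnit χ v.1).ne_zero]

theorem circlePoint_injective (hN : 3 ≤ N) :
    Function.Injective (circlePoint : ZMod N × Fin 2 → ℂ) := by
  have h0 := weight_pos hN (0 : ZMod N)
  have h1 := weight_pos hN (1 : ZMod N)
  have hratio : weight (1 : ZMod N) / weight (0 : ZMod N) ≠ 1 :=
    mt (div_eq_one_iff_eq h0.ne').1 (weight_one_ne_weight_zero hN)
  have hnorm (v : ZMod N × Fin 2) :
      ‖circlePoint v‖ = (weight (1 : ZMod N) / weight (0 : ZMod N)) ^ (v.2 : ℕ) := by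
    simp [circlePoint, abs_of_pos h0, abs_of_pos h1]
  intro v w h
  have hlayer : v.2 = w.2 := Fin.val_injective <|
    pow_right_injective₀ (div_pos h1 h0) hratio (by simpa only [hnorm] using congrArg norm h)
  have hratio0 : (weight (1 : ZMod N) / weight (0 : ZMod N) : ℂ) ≠ 0 := by
    exact_mod_cast (div_pos h1 h0).ne'
  simp only [circlePoint, hlayer] at h
  exact Prod.ext (ZMod.injective_stdAddChar (mul_left_cancel₀ (pow_ne_zero _ hratio0) h)) hlayer

theorem circlePoint_pow_mul_inv (hN : 3 ≤ N) {k : ℕ} (hk : k < 3) (t : ZMod N) (s : Fin 2) :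
    circlePoint (t, s) ^ k * (circlePoint (t, s))⁻¹ =
      (weight (k - 1 : ZMod N) / weight (0 : ZMod N) : ℂ) ^ (s : ℕ) * χ (t * (k - 1)) := by
  have h0 : (weight (0 : ZMod N) : ℂ) ≠ 0 := by exact_mod_cast (weight_pos hN _).ne'
  have h1 : (weight (1 : ZMod N) : ℂ) ≠ 0 := by exact_mod_cast (weight_pos hN _).ne'
  have hprod : (weight (1 : ZMod N) * weight (-1 : ZMod N) : ℂ) = weight (0 : ZMod N) ^ 2 := by
    exact_mod_cast weight_mul_weight_neg_of_mem (j := (1 : ZMod N)) (by simp [singularFrequencies])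
  interval_cases k
  · have hinv : (weight (1 : ZMod N) / weight (0 : ZMod N) : ℂ)⁻¹ =
        weight (-1 : ZMod N) / weight (0 : ZMod N) := by
      field_simp
      linear_combination -hprod
    rw [Nat.cast_zero, zero_sub, ← hinv, inv_pow, mul_neg_one, AddChar.map_neg_eq_inv, pow_zero,
      one_mul, circlePoint, mul_inv]
  · simp [mul_inv_cancel₀ (circlePoint_ne_zero hN (t, s)), h0]
  · rw [sq, mul_inv_cancel_right₀ (circlePoint_ne_zero hN (t, s)), circlePoint]
    norm_num

theorem sum_circlePoint_pow_mul (hN : 3 ≤ N) {z : EuclideanSpace ℂ (ZMod N × Fin 2)}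
    (hz : z ∈ vanishingSubspace ℂ (singularCoordinates N)) {k : ℕ} (hk : k < 3) :
    ∑ v, circlePoint v ^ k *
      ((-1) ^ (v.2 : ℕ) * (circlePoint v)⁻¹ * inner ℂ (circulantVector v) z) = 0 := by
  have hmem : (k - 1 : ZMod N) ∈ singularFrequencies N := by
    interval_cases k <;> norm_num [singularFrequencies]
  have h0 : (weight (0 : ZMod N) : ℂ) ≠ 0 := by exact_mod_cast (weight_pos hN _).ne'
  have hlayer (s : Fin 2) : ∑ t, circlePoint (t, s) ^ k * ((-1) ^ (s : ℕ) *
      (circlePoint (t, s))⁻¹ * inner ℂ (circulantVector (t, s)) z) =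
      (-(weight (k - 1 : ZMod N) / weight (0 : ZMod N) : ℂ)) ^ (s : ℕ) *
        (N * layerSpectrum z s (k - 1)) := by
    rw [← sum_stdAddChar_mul_inner_circulantVector, Finset.mul_sum]
    refine Finset.sum_congr rfl fun t _ => ?_
    rw [neg_pow]
    linear_combination (-1) ^ (s : ℕ) * inner ℂ (circulantVector (t, s)) z *
      circlePoint_pow_mul_inv hN hk t s
  have hspectrum := weight_zero_mul_layerSpectrum hN hz hmem
  simp only [Fintype.sum_prod_type_right, Fin.sum_univ_two, hlayer]
  simp only [Fin.val_zero, pow_zero, one_mul, Fin.val_one, pow_one]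
  field_simp
  linear_combination (N : ℂ) * hspectrum

theorem three_lt_card_inner_circulantVector_ne_zero (hN : 3 ≤ N)
    {z : EuclideanSpace ℂ (ZMod N × Fin 2)}
    (hz : z ∈ vanishingSubspace ℂ (singularCoordinates N)) (hz0 : z ≠ 0) :
    3 < #{v | inner ℂ (circulantVector v) z ≠ 0} := by
  obtain ⟨v, hv⟩ : ∃ v, inner ℂ (circulantVector v) z ≠ 0 := by
    by_contra! h
    exact hz0 (eq_zero_of_inner_circulantVector_eq_zero hN hz h)
  have hne := circlePoint_ne_zero hN
  simpa [hne] using lt_card_filter_ne_zero_of_sum_pow_mul_eq_zero (circlePoint_injective hN)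
    (Function.ne_iff.2 ⟨v, by simp [hne, hv]⟩) fun k hk => sum_circlePoint_pow_mul hN hz hk

end CirculantParty

section Construction

theorem card_singularCoordinates {N : ℕ} (hN : 3 ≤ N) : #(singularCoordinates N) = 3 := by
  have : Fact (1 < N) := ⟨by omega⟩
  have : Fact (2 < N) := ⟨hN⟩
  rw [singularCoordinates, Finset.card_product, Finset.card_singleton, mul_one,
    singularFrequencies, Finset.card_eq_three]
  exact ⟨0, 1, -1, zero_ne_one, by simp [eq_comm], ZMod.neg_one_ne_one.symm, rfl⟩

theorem exists_isUnextendibleFamily_prism {m : ℕ} [NeZero (2 * m)] (hm : 2 ≤ m) :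
    ∃ (a b : ZMod (2 * m) × Fin 2 → EuclideanSpace ℂ (Fin 2))
      (c : ZMod (2 * m) × Fin 2 → vanishingSubspace ℂ (singularCoordinates (2 * m))),
      IsUnextendibleFamily a b c := by
  have hN : 3 ≤ 2 * m := by omega
  obtain ⟨a, b, hne, hadj, hacard, hbcard⟩ := exists_planar_families m
  let c (v : ZMod (2 * m) × Fin 2) : vanishingSubspace ℂ (singularCoordinates (2 * m)) :=
    ⟨circulantVector v, circulantVector_mem hN v⟩
  have hc (v) : c v ≠ 0 := Subtype.coe_ne_coe.1 (circulantVector_ne_zero hN v)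
  refine ⟨a, b, c, fun v => ⟨(hne v).1, (hne v).2, hc v⟩, fun v w hvw => ?_,
    fun x y z hx hy hz => ?_⟩
  · by_cases h : (prismGraph (2 * m)).Adj v w
    · exact or_assoc.1 (.inl (hadj v w h))
    · exact .inr (.inr (inner_circulantVector_eq_zero hN hvw h))
  · have hx_card := hacard x hx {v | inner ℂ (a v) x = 0} (by simp)
    have hy_card := hbcard y hy {v | inner ℂ (b v) y = 0} (by simp)
    have hz_card := three_lt_card_inner_circulantVector_ne_zero hN z.2 (by simpa using hz)
    have hunion := Finset.card_union_le ({v | inner ℂ (a v) x = 0} : Finset _)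
      {v | inner ℂ (b v) y = 0}
    obtain ⟨v, hv, hvab⟩ := Finset.exists_mem_notMem_of_card_lt_card
      (hunion.trans_lt (lt_of_le_of_lt (add_le_add hx_card hy_card) hz_card))
    simp only [Finset.mem_filter_univ, Finset.mem_union, not_or] at hv hvab
    exact ⟨v, hvab.1, hvab.2, hv⟩

theorem four_mul_mem_upbSizes {m : ℕ} (hm : 2 ≤ m) : 4 * m ∈ upbSizes 2 2 (4 * m - 3) := by
  have : NeZero (2 * m) := ⟨by omega⟩
  obtain ⟨a, b, c, h⟩ := exists_isUnextendibleFamily_prism hm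
  have hmem := h.card_mem_upbSizes
  rw [finrank_vanishingSubspace, card_singularCoordinates (by omega), finrank_euclideanSpace_fin,
    Fintype.card_prod, ZMod.card, Fintype.card_fin] at hmem
  rwa [show 2 * m * 2 = 4 * m by ring] at hmem

end Construction

theorem theorem2 (k : ℕ) (hk : 0 < k) :
    IsMinUPBSize 2 2 (4 * k + 1) (fN 2 2 (4 * k + 1) + 1) ∧
      fN 2 2 (4 * k + 1) + 1 = 4 * k + 4 := by
  have hvalue : fN 2 2 (4 * k + 1) + 1 = 4 * k + 4 := by
    rw [fN]
    omega
  refine ⟨?_, hvalue⟩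
  rw [hvalue]
  refine ⟨four_mul_mem_upbSizes (m := k + 1) (by omega), fun n hn => ?_⟩
  exact le_of_mem_upbSizes_two_two ⟨2 * k, by ring⟩ hn
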